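/- Notation. For $f,g\in\omega^\omega$ write $f\le^* g$ if $f(n)\le g(n)$ for all but finitely many $n$; "increasing" means $f(n)\le f(n+1)$ for all $n$. For a cardinal $\kappa$, $\mathsf H(\kappa)$ is the collection of sets whose transitive closure has size less than $\kappa$, and, for a fixed well order $\trianglelefteq$ of $\mathsf H(\kappa)$, $\mathsf{Sub}(\kappa)$ is the set of all countable $M\subseteq\mathsf H(\kappa)$ such that $(M,\in,\trianglelefteq)$ is an elementary submodel of $(\mathsf H(\kappa),\in,\trianglelefteq)$. The height of $M\in\mathsf{Sub}(\kappa)$ (for $\kappa>\omega_1$) is the countable ordinal $\delta_M=M\cap\omega_1$. A relation $R\subseteq(\omega^\omega)^{k}\times\omega^\omega$ is $\le^*$-adequate if for all $x_1,\dots,x_k\in\omega^\omega$ there is $f\in\omega^\omega$ such that $R(x_1,\dots,x_k,g)$ holds for every increasing $g\in\omega^\omega$ with $g\not\le^* f$. Let $\kappa>\mathfrak c$ be a regular cardinal, $\trianglelefteq$ a well order of $\mathsf H(\kappa)$, $\mathcal B=\langle f_\alpha\mid\alpha<\omega_1\rangle$ a sequence of increasing functions in $\omega^\omega$, and $\mathcal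 S\subseteq\mathsf{Sub}(\kappa)$ a stationary family of countable subsets of $\mathsf H(\kappa)$ (it meets every closed unbounded family of countable subsets of $\mathsf H(\kappa)$) such that $\mathcal B\in M$ for every $M\in\mathcal S$. The pair $(\mathcal B,\mathcal S)$ is a multiple $\mathfrak d$-pathway if for every $n\in\omega$, all $M_0,\dots,M_n\in\mathcal S$ with $\delta_{M_0}\le\dots\le\delta_{M_n}$, every projective $\le^*$-adequate relation $R\subseteq(\omega^\omega)^{n+1}\times\omega^\omega$ with $R\in M_n$, and all $x_i\in M_i\cap\omega^\omega$ ($i\le n$), the relation $R(x_0,\dots,x_n,f_{\delta_{M_n}})$ holds. Theorem. If there is a multiple $\mathfrak d$-pathway (for some such $\kappa$ and $\trianglelefteq$), then there is a Gruff ultrafilter, that is, a non-principal ultrafilter $\mathcal U$ on $\mathbb Q$ with a base of perfect sets: every element of $\mathcal U$ contains an element of $\mathcal U$ that is a closed, non-empty subset of $\mathbb Q$ without isolated points. -/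

import Mathlib

universe u v

/-! ### The Baire space, projective sets, adequate relations -/

/-- `f ≤* g`: `f n ≤ g n` for all but finitely many `n`. -/
def LeStar (f g : ℕ → ℕ) : Prop :=
  {n : ℕ | ¬ f n ≤ g n}.Finite

/-- The pointclasses `Σ¹ₙ₊₁` on the topological space `X` (used for Polish spaces): `Σ¹₁` consists of
the analytic sets, and a set is `Σ¹ₙ₊₂` if it is the projection to `X` of a subset of `X × ω^ω`
whose complement is `Σ¹ₙ₊₁`. -/
def IsSigmaOne : ℕ → ∀ (X : Type) [TopologicalSpace X], Set X → Prop
  | 0, _, _, A => MeasureTheory.AnalyticSet A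
  | n + 1, X, _, A =>
      ∃ C : Set (X × (ℕ → ℕ)), IsSigmaOne n (X × (ℕ → ℕ)) Cᶜ ∧ A = Prod.fst '' C

/-- Projective sets. -/
def IsProjective {X : Type} [TopologicalSpace X] (A : Set X) : Prop :=
  ∃ n : ℕ, IsSigmaOne n X A

/-- A relation `R ⊆ X^k × ω^ω` is `≤*`-adequate if every `x ∈ X^k` has a control. -/
def IsAdequate {X : Type v} {k : ℕ} (R : Set ((Fin k → X) × (ℕ → ℕ))) : Prop :=
  ∀ x : Fin k → X, ∃ f : ℕ → ℕ, ∀ g : ℕ → ℕ, Monotone g → ¬ LeStar g f → (x, g) ∈ R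

/-! ### The structure `(H(κ), ∈, ⊴)` and its countable elementary submodels -/

/-- The members of the transitive closure of the set `x`. -/
def trcl (x : ZFSet.{u}) : Set ZFSet.{u} :=
  {y | Relation.TransGen (fun a b : ZFSet.{u} => a ∈ b) y x}

/-- `H(κ)`: the sets whose transitive closure has size less than `κ`. -/
def hSet (κ : Cardinal.{u}) : Set ZFSet.{u} :=
  {x | Cardinal.mk (trcl x) < Cardinal.lift.{u + 1} κ}

/-- Two binary relation symbols, for membership and for a well order. -/
inductive SetLangRel : ℕ → Type
  | mem : SetLangRel 2
  | wo : SetLangRel 2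

/-- The first-order language with the two symbols `∈` and `⊴`. -/
def setLang : FirstOrder.Language.{0, 0} :=
  ⟨fun _ => Empty, SetLangRel⟩

/-- `(H(κ), ∈, r)` as a first-order structure. -/
@[reducible] def hStructure (κ : Cardinal.{u}) (r : hSet κ → hSet κ → Prop) :
    setLang.Structure (hSet κ) where
  funMap := fun f => Empty.elim f
  RelMap := fun {_} R x =>
    match R, x with
    | SetLangRel.mem, x => (x 0 : ZFSet.{u}) ∈ (x 1 : ZFSet.{u})
    | SetLangRel.wo, x => r (x 0) (x 1)

/-- `Sub(κ)`: the countable `M ⊆ H(κ)` such that `(M, ∈, r)` is an elementary submodel of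
`(H(κ), ∈, r)`. -/
def subModels (κ : Cardinal.{u}) (r : hSet κ → hSet κ → Prop) : Set (Set ZFSet.{u}) :=
  letI := hStructure κ r
  {M | M.Countable ∧ ∃ N : setLang.ElementarySubstructure (hSet κ),
    M = Subtype.val '' (N : Set (hSet κ))}

/-- The first uncountable ordinal. -/
noncomputable abbrev omegaOne : Ordinal.{u} := Ordinal.omega 1

/-- The height `δ_M = M ∩ ω₁`, as the least ordinal that is not in `M ∩ ω₁`. (For a countable
elementary submodel `M` of `H(κ)`, where `κ > ω₁`, the set `M ∩ ω₁` is a countable ordinal.) -/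
noncomputable def height (M : Set ZFSet.{u}) : Ordinal.{u} :=
  sInf {α : Ordinal.{u} | ¬ (α < omegaOne ∧ α.toZFSet ∈ M)}

/-! ### Stationary families of countable sets -/

/-- `C` is a club in `[A]^{≤ω}`: it is a cofinal family of countable subsets of `A` that is closed
under unions of increasing `ω`-sequences. -/
def IsClubFamily {X : Type v} (A : Set X) (C : Set (Set X)) : Prop :=
  (∀ M ∈ C, M ⊆ A ∧ M.Countable) ∧
  (∀ Z : Set X, Z ⊆ A → Z.Countable → ∃ M ∈ C, Z ⊆ M) ∧
  (∀ M : ℕ → Set X, Monotone M → (∀ i, M i ∈ C) → (⋃ i, M i) ∈ C)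

/-- `S` is a stationary family of countable subsets of `A`: it meets every club. -/
def IsStationaryFamily {X : Type v} (A : Set X) (S : Set (Set X)) : Prop :=
  (∀ M ∈ S, M ⊆ A ∧ M.Countable) ∧ ∀ C : Set (Set X), IsClubFamily A C → (S ∩ C).Nonempty

/-! ### Reals, tuples, relations and `ω₁`-sequences of reals as sets -/

/-- The natural number `n` as a finite von Neumann ordinal. -/
noncomputable def natCode (n : ℕ) : ZFSet.{u} :=
  (n : Ordinal.{u}).toZFSet

/-- A function `ω → ω` as a set of ordered pairs. -/
noncomputable def realCode (f : ℕ → ℕ) : ZFSet.{u} :=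
  ZFSet.range fun n : ℕ => ZFSet.pair (natCode.{u} n) (natCode.{u} (f n))

/-- An element of `(ω^ω)^k`, as a function with domain `k = {0, …, k - 1}`. -/
noncomputable def tupleCode {k : ℕ} (x : Fin k → ℕ → ℕ) : ZFSet.{u} :=
  ZFSet.range fun i : Fin k => ZFSet.pair (natCode.{u} i) (realCode.{u} (x i))

/-- A relation `R ⊆ (ω^ω)^k × ω^ω` as a set of ordered pairs. -/
noncomputable def relCode {k : ℕ} (R : Set ((Fin k → ℕ → ℕ) × (ℕ → ℕ))) : ZFSet.{u} :=
  ZFSet.range fun p : R => ZFSet.pair (tupleCode.{u} p.1.1) (realCode.{u} p.1.2)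

/-- The sequence `⟨f α | α < ω₁⟩` as a function with domain `ω₁`. -/
noncomputable def seqCode (f : Ordinal.{u} → ℕ → ℕ) : ZFSet.{u} :=
  ZFSet.range fun α : Set.Iio (omegaOne.{u}) =>
    ZFSet.pair (α : Ordinal.{u}).toZFSet (realCode.{u} (f α))

/-! ### Multiple `𝔡`-pathways -/

/-- `(⟨f α | α < ω₁⟩, S)` is a multiple `𝔡`-pathway, with respect to the regular cardinal `κ > 𝔠`
and the well order `r` of `H(κ)`. Only the values `f α` with `α < ω₁` matter. -/
structure IsMultipleDPathway (κ : Cardinal.{u}) (r : hSet κ → hSet κ → Prop)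
    (f : Ordinal.{u} → ℕ → ℕ) (S : Set (Set ZFSet.{u})) : Prop where
  regular : κ.IsRegular
  continuum_lt : Cardinal.continuum.{u} < κ
  wellOrder : IsWellOrder (hSet κ) r
  increasing : ∀ α < omegaOne, Monotone (f α)
  subset : S ⊆ subModels κ r
  stationary : IsStationaryFamily (hSet κ) S
  seq_mem : ∀ M ∈ S, seqCode f ∈ M
  pathway : ∀ (n : ℕ) (M : Fin (n + 1) → Set ZFSet.{u}), (∀ i, M i ∈ S) →
    (∀ i j, i ≤ j → height (M i) ≤ height (M j)) →
    ∀ R : Set ((Fin (n + 1) → ℕ → ℕ) × (ℕ → ℕ)), IsProjective R → IsAdequate R →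
      relCode R ∈ M (Fin.last n) →
      ∀ x : Fin (n + 1) → ℕ → ℕ, (∀ i, realCode (x i) ∈ M i) →
        (x, f (height (M (Fin.last n)))) ∈ R

/-! ### Gruff ultrafilters -/

/-- A non-principal ultrafilter on `ℚ` is Gruff if it has a base of perfect (that is, closed,
non-empty and crowded) sets. -/
def IsGruff (U : Ultrafilter ℚ) : Prop :=
  (U : Filter ℚ) ≤ Filter.cofinite ∧
  ∃ B : Set (Set ℚ), (∀ P ∈ B, P ∈ U ∧ Perfect P ∧ P.Nonempty) ∧ ∀ A ∈ U, ∃ P ∈ B, P ⊆ A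

/-! Call a set of rationals positive if it contains a crowded set unbounded to the right.
Non-positive sets form an ideal (`Positive.or_of_union`), and an ultrafilter of positive sets in
which every member contains a closed member is Gruff (`isGruff_of_closed_base`).

Closed members come from `closedPart X f`: it is closed for every increasing `f`, monotone in `X`,
and positive when `X` is positive and `f` escapes a bound depending on `X`
(`Positive.exists_control`). By monotonicity the closed part of an intersection lies in the
intersection of the closed parts, so one bound serves a finite meet. Hence `meetRel` is adequate; it
is also projective, so the pathway applies to it.

Let `L δ` be the reals in suitable models of height at most `δ` (`exists_increasing_cover`). By
recursion on `δ`, `W δ` is an ultrafilter of positive sets containing the closed parts along `f δ'`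
of those members of `W δ'` that are coded in `L δ'`, for all heights `δ' < δ`. Finite meets stay
positive because `meetRel` holds at the largest height involved (`exists_extendsFamily`). The same
argument over all heights gives the final ultrafilter. Every set and its complement are coded in
some `L δ`, and `W δ` contains one of them, whose closed part is then in the final ultrafilter. -/

open Set Filter Topology MeasureTheory

/-! ### A sequence of clopen partitions of the rationals -/

/-- The index of the cell of `q` in the `n`-th dyadic partition of `ℚ`, shifted by `√2`. -/
noncomputable def cell (n : ℕ) (q : ℚ) : ℤ := ⌊(2 : ℝ) ^ n * (q + √2)⌋

theorem cell_eq_of_succ {n : ℕ} {p q : ℚ} (h : cell (n + 1) p = cell (n + 1) q) :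
    cell n p = cell n q := by
  have key : ∀ r : ℚ, cell n r = cell (n + 1) r / 2 := by
    intro r
    have h1 := Int.floor_le ((2 : ℝ) ^ (n + 1) * (r + √2))
    have h2 := Int.lt_floor_add_one ((2 : ℝ) ^ (n + 1) * (r + √2))
    change ((cell (n + 1) r : ℤ) : ℝ) ≤ _ at h1
    change _ < ((cell (n + 1) r : ℤ) : ℝ) + 1 at h2
    have h3 : (2 : ℝ) ^ (n + 1) * (r + √2) = 2 * ((2 : ℝ) ^ n * (r + √2)) := by ring
    rw [h3] at h1 h2
    unfold cell at h1 h2 ⊢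
    rw [Int.floor_eq_iff]
    set k := ⌊(2 : ℝ) ^ (n + 1) * (r + √2)⌋ with hk
    have e1 : 2 * (k / 2) ≤ k := by omega
    have e2 : k + 1 ≤ 2 * (k / 2) + 2 := by omega
    have e1' : (2 : ℝ) * ((k / 2 : ℤ) : ℝ) ≤ k := by exact_mod_cast e1
    have e2' : (k : ℝ) + 1 ≤ 2 * ((k / 2 : ℤ) : ℝ) + 2 := by exact_mod_cast e2
    constructor <;> linarith
  rw [key, key, h]

theorem cell_eq_of_le {n m : ℕ} (hnm : n ≤ m) {p q : ℚ} (h : cell m p = cell m q) :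
    cell n p = cell n q := by
  induction hnm with
  | refl => exact h
  | step _ ih => exact ih (cell_eq_of_succ h)

theorem isOpen_cell (n : ℕ) (k : ℤ) : IsOpen {p : ℚ | cell n p = k} := by
  -- The irrational shift keeps rationals off the endpoints, so the half-open cells are open in `ℚ`.
  have hirr : ∀ p : ℚ, ∀ j : ℤ, (2 : ℝ) ^ n * (p + √2) ≠ j := by
    intro p j hj
    have : √2 = ((j / 2 ^ n - p : ℚ) : ℝ) := by
      push_cast
      rw [← hj]
      field_simp
      ring
    exact irrational_sqrt_two ⟨_, this.symm⟩
  have : {p : ℚ | cell n p = k} =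
      (fun p : ℚ => (2 : ℝ) ^ n * (p + √2)) ⁻¹' Ioo (k : ℝ) (k + 1) := by
    ext p
    simp only [mem_ofPred_eq, cell, Int.floor_eq_iff, mem_preimage, mem_Ioo]
    exact and_congr_left fun _ => ⟨fun h => lt_of_le_of_ne h (hirr p k).symm, le_of_lt⟩
  rw [this]
  exact isOpen_Ioo.preimage (by have := Rat.continuous_coe_real; fun_prop)

theorem cell_mem_nhds (n : ℕ) (q : ℚ) : {p : ℚ | cell n p = cell n q} ∈ 𝓝 q :=
  (isOpen_cell n _).mem_nhds rfl

theorem exists_cell_subset {q : ℚ} {V : Set ℚ} (hV : V ∈ 𝓝 q) :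
    ∃ n, {p : ℚ | cell n p = cell n q} ⊆ V := by
  obtain ⟨ε, hε, hb⟩ := Metric.mem_nhds_iff.1 hV
  obtain ⟨n, hn⟩ := exists_pow_lt_of_lt_one hε (by norm_num : (1 / 2 : ℝ) < 1)
  refine ⟨n, fun p hp => hb ?_⟩
  have h1 := Int.abs_sub_lt_one_of_floor_eq_floor (show ⌊_⌋ = ⌊_⌋ from hp)
  rw [Metric.mem_ball, Rat.dist_eq]
  refine lt_trans ?_ hn
  rw [← mul_sub, abs_mul, abs_of_pos (by positivity : (0 : ℝ) < 2 ^ n),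
    add_sub_add_right_eq_sub] at h1
  rwa [one_div, inv_pow, ← one_div, lt_div_iff₀' (by positivity)]

theorem exists_cell_ne {p q : ℚ} (h : p ≠ q) : ∃ n, cell n p ≠ cell n q := by
  obtain ⟨n, hn⟩ := exists_cell_subset (isOpen_compl_singleton.mem_nhds (Ne.symm h) : {p}ᶜ ∈ 𝓝 q)
  exact ⟨n, fun e => hn e rfl⟩

theorem exists_le_cell_zero (n : ℕ) : ∃ q : ℚ, (n : ℤ) ≤ cell 0 q := by
  refine ⟨n, Int.le_floor.2 ?_⟩
  have := Real.sqrt_nonneg 2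
  push_cast
  linarith

/-! ### Crowded and positive sets -/

/-- A set of rationals without isolated points. -/
def Crowded (X : Set ℚ) : Prop :=
  ∀ q ∈ X, ∀ n, ∃ p ∈ X, p ≠ q ∧ cell n p = cell n q

/-- A set of rationals that is unbounded to the right. -/
def UnboundedRight (X : Set ℚ) : Prop :=
  ∀ n : ℕ, ∃ q ∈ X, (n : ℤ) ≤ cell 0 q

/-- A set of rationals that contains a crowded set which is unbounded to the right. -/
def Positive (X : Set ℚ) : Prop :=
  ∃ Z ⊆ X, Crowded Z ∧ UnboundedRight Z

theorem Positive.mono {X Y : Set ℚ} (h : Positive X) (hXY : X ⊆ Y) : Positive Y := by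
  obtain ⟨Z, hZ, h'⟩ := h
  exact ⟨Z, hZ.trans hXY, h'⟩

theorem Crowded.inter_cell {X : Set ℚ} (h : Crowded X) {A : Set ℚ} {m : ℕ}
    (hA : ∀ p q, cell m p = cell m q → q ∈ A → p ∈ A) : Crowded (X ∩ A) := by
  rintro q ⟨hq, hqA⟩ n
  obtain ⟨p, hp, hne, hc⟩ := h q hq (max n m)
  exact ⟨p, ⟨hp, hA p q (cell_eq_of_le (le_max_right _ _) hc) hqA⟩, hne,
    cell_eq_of_le (le_max_left _ _) hc⟩

theorem crowded_sUnion {S : Set (Set ℚ)} (h : ∀ Z ∈ S, Crowded Z) : Crowded (⋃₀ S) := by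
  rintro q ⟨Z, hZ, hq⟩ n
  obtain ⟨p, hp, h'⟩ := h Z hZ q hq n
  exact ⟨p, ⟨Z, hZ, hp⟩, h'⟩

theorem crowded_univ : Crowded univ := by
  intro q _ n
  have : AccPt q (𝓟 univ) := PerfectSpace.univ_preperfect q trivial
  obtain ⟨p, ⟨hp, -⟩, hne⟩ := accPt_iff_nhds.1 this _ (cell_mem_nhds n q)
  exact ⟨p, trivial, hne, hp⟩

theorem positive_univ : Positive univ :=
  ⟨univ, subset_rfl, crowded_univ, fun n =>
    (exists_le_cell_zero n).imp fun _ h => ⟨trivial, h⟩⟩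

/-- The largest crowded subset. -/
def crowdedKernel (X : Set ℚ) : Set ℚ := ⋃₀ {Z | Z ⊆ X ∧ Crowded Z}

theorem crowdedKernel_subset (X : Set ℚ) : crowdedKernel X ⊆ X :=
  sUnion_subset fun _ h => h.1

theorem crowded_crowdedKernel (X : Set ℚ) : Crowded (crowdedKernel X) :=
  crowded_sUnion fun _ h => h.2

theorem subset_crowdedKernel {X Z : Set ℚ} (h : Z ⊆ X) (hZ : Crowded Z) : Z ⊆ crowdedKernel X :=
  subset_sUnion_of_mem ⟨h, hZ⟩

theorem not_positive_diff_crowdedKernel (X : Set ℚ) : ¬ Positive (X \ crowdedKernel X) := by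
  rintro ⟨Z, hZ, hc, hu⟩
  obtain ⟨q, hq, -⟩ := hu 0
  exact (hZ hq).2 (subset_crowdedKernel (hZ.trans sdiff_subset) hc hq)

theorem Crowded.perfect {X : Set ℚ} (h : Crowded X) (hX : IsClosed X) : Perfect X := by
  refine ⟨hX, fun q hq => accPt_iff_nhds.2 fun V hV => ?_⟩
  obtain ⟨n, hn⟩ := exists_cell_subset hV
  obtain ⟨p, hp, hne, hc⟩ := h q hq n
  exact ⟨p, ⟨hn hc, hp⟩, hne⟩

/-- Adding to the kernel a limit point that lies in `X` leaves it crowded, so maximality already put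
the point there. -/
theorem isClosed_crowdedKernel {X : Set ℚ} (hX : IsClosed X) : IsClosed (crowdedKernel X) := by
  refine isClosed_of_closure_subset fun q hq => ?_
  have hqX : q ∈ X := closure_minimal (crowdedKernel_subset X) hX hq
  by_contra hqK
  refine hqK (subset_crowdedKernel (insert_subset hqX (crowdedKernel_subset X)) ?_
    (mem_insert q (crowdedKernel X)))
  rintro r (rfl | hr) n
  · obtain ⟨p, hp, hpK⟩ := mem_closure_iff_nhds.1 hq _ (cell_mem_nhds n r)
    exact ⟨p, mem_insert_of_mem _ hpK, fun e => hqK (e ▸ hpK), hp⟩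
  · obtain ⟨p, hp, h⟩ := crowded_crowdedKernel X r hr n
    exact ⟨p, mem_insert_of_mem _ hp, h⟩

/-- Either `X` is dense in `Z`, and then `Z ∩ X` is crowded, or some cell meeting `Z` misses `Z ∩
X`, and the part of `Z` in that cell lies in `Y`. -/
theorem Crowded.exists_crowded_of_subset_union {Z X Y : Set ℚ} (hZ : Crowded Z) (hne : Z.Nonempty)
    (h : Z ⊆ X ∪ Y) :
    ∃ V ⊆ Z, V.Nonempty ∧ Crowded V ∧ (V ⊆ X ∨ V ⊆ Y) := by
  by_cases hd : ∀ q ∈ Z, ∀ n, ∃ p ∈ Z ∩ X, cell n p = cell n q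
  · refine ⟨Z ∩ X, inter_subset_left, ?_, ?_, Or.inl inter_subset_right⟩
    · obtain ⟨q, hq⟩ := hne
      obtain ⟨p, hp, -⟩ := hd q hq 0
      exact ⟨p, hp⟩
    · rintro q ⟨hq, -⟩ n
      obtain ⟨p, hp, hpq, hc⟩ := hZ q hq n
      obtain ⟨m, hm⟩ := exists_cell_ne hpq
      obtain ⟨r, hr, hrp⟩ := hd p hp (max n m)
      refine ⟨r, hr, ?_, (cell_eq_of_le (le_max_left _ _) hrp).trans hc⟩
      rintro rfl
      exact hm (cell_eq_of_le (le_max_right _ _) hrp).symm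
  · push Not at hd
    obtain ⟨q, hq, n, hn⟩ := hd
    refine ⟨Z ∩ {p | cell n p = cell n q}, inter_subset_left, ⟨q, hq, rfl⟩,
      hZ.inter_cell (m := n) fun _ _ h1 h2 => h1.trans h2, Or.inr ?_⟩
    rintro p ⟨hp, hpq⟩
    exact (h hp).resolve_left fun hX => hn p ⟨hp, hX⟩ hpq

/-- If neither set is positive, both crowded kernels are bounded on the right. Beyond both bounds
`Z` still has a crowded piece inside `X` or `Y`, which would belong to that kernel. -/
theorem Positive.or_of_union {X Y : Set ℚ} (h : Positive (X ∪ Y)) : Positive X ∨ Positive Y := by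
  obtain ⟨Z, hZ, hc, hu⟩ := h
  by_contra! hcon
  have key : ∀ X : Set ℚ, ¬ Positive X → ∃ n : ℕ, ∀ q ∈ crowdedKernel X, cell 0 q < n := by
    intro X hX
    by_contra! hb
    exact hX ⟨_, crowdedKernel_subset X, crowded_crowdedKernel X, hb⟩
  obtain ⟨n, hn⟩ := key X hcon.1
  obtain ⟨m, hm⟩ := key Y hcon.2
  obtain ⟨q, hq, hqn⟩ := hu (max n m)
  obtain ⟨V, hVZ, ⟨p, hp⟩, hVc, hV⟩ := (hc.inter_cell (A := {p | ((max n m : ℕ) : ℤ) ≤ cell 0 p})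
    (m := 0) (fun _ _ h1 h2 => by rw [mem_ofPred_eq, h1]; exact h2)).exists_crowded_of_subset_union
    ⟨q, hq, hqn⟩ (inter_subset_left.trans hZ)
  have h1 := (hVZ hp).2
  simp only [mem_ofPred_eq, Nat.cast_max, max_le_iff] at h1
  rcases hV with hV | hV
  · exact (hn p (subset_crowdedKernel hV hVc hp)).not_ge h1.1
  · exact (hm p (subset_crowdedKernel hV hVc hp)).not_ge h1.2

/-- The filter dual to the ideal of sets that are not positive. -/
def positiveDual : Filter ℚ where
  sets := {A | ¬ Positive Aᶜ}
  univ_sets := by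
    rintro ⟨Z, hZ, -, hu⟩
    obtain ⟨q, hq, -⟩ := hu 0
    exact hZ hq trivial
  sets_of_superset := fun h hs h' => h (h'.mono (compl_subset_compl.2 hs))
  inter_sets := fun {A B} hA hB h => by
    rw [compl_inter] at h
    exact h.or_of_union.elim hA hB

/-- Any ultrafilter finer than both the filter generated by `g` and the dual of the non-positive
ideal works; positivity of finite meets makes the two compatible. -/
theorem exists_ultrafilter_positive {g : Set (Set ℚ)}
    (hg : ∀ t ⊆ g, t.Finite → Positive (⋂₀ t)) :
    ∃ W : Ultrafilter ℚ, (∀ A ∈ W, Positive A) ∧ ∀ A ∈ g, A ∈ W := by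
  have : NeBot (generate g ⊓ positiveDual) := by
    rw [inf_neBot_iff]
    intro A hA B hB
    obtain ⟨t, htg, htf, ht⟩ := mem_generate_iff.1 hA
    by_contra hne
    rw [not_nonempty_iff_eq_empty, ← disjoint_iff_inter_eq_empty] at hne
    exact hB (((hg t htg htf).mono ht).mono hne.subset_compl_right)
  refine ⟨Ultrafilter.of (generate g ⊓ positiveDual), fun A hA => ?_, fun A hA => ?_⟩
  · by_contra hp
    have h1 : Aᶜ ∈ positiveDual := show ¬ Positive Aᶜᶜ by rwa [compl_compl]
    exact Ultrafilter.compl_mem_iff_notMem.1 (Ultrafilter.of_le _ (mem_inf_of_right h1)) hA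
  · exact Ultrafilter.of_le _ (mem_inf_of_left (mem_generate_of_mem hA))

/-! ### Closed parts -/

theorem exists_separating (m : ℕ) : ∃ s : ℕ, ∀ p q : ℚ, Encodable.encode p < m →
    Encodable.encode q < m → cell s p = cell s q → p = q := by
  have hfin : {p : ℚ | Encodable.encode p < m}.Finite :=
    (finite_Iio m).preimage Encodable.encode_injective.injOn
  have : ∀ x : ℚ × ℚ, ∃ n, x.1 ≠ x.2 → cell n x.1 ≠ cell n x.2 := fun x => by
    by_cases hx : x.1 = x.2
    · exact ⟨0, fun h => absurd hx h⟩
    · exact (exists_cell_ne hx).imp fun _ h _ => h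
  choose N hN using this
  obtain ⟨s, hs⟩ := ((hfin.prod hfin).image N).bddAbove
  refine ⟨s, fun p q hp hq h => ?_⟩
  by_contra hne
  exact hN (p, q) hne (cell_eq_of_le (hs ⟨(p, q), ⟨hp, hq⟩, rfl⟩) h)

/-- A level, at least `m`, whose partition separates all rationals with code less than `m`. -/
noncomputable def sepLevel (m : ℕ) : ℕ := ∑ i ∈ Finset.range (m + 1), ((exists_separating i).choose + i)

theorem sepLevel_mono : Monotone sepLevel := fun a b h =>
  Finset.sum_le_sum_of_subset (Finset.range_mono (by omega))

theorem sepLevel_ge (m : ℕ) : (exists_separating m).choose + m ≤ sepLevel m :=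
  Finset.single_le_sum (f := fun i => (exists_separating i).choose + i) (fun _ _ => Nat.zero_le _)
    (Finset.self_mem_range_succ m)

theorem le_sepLevel (m : ℕ) : m ≤ sepLevel m := (Nat.le_add_left _ _).trans (sepLevel_ge m)

theorem eq_of_cell_sepLevel {m : ℕ} {p q : ℚ} (hp : Encodable.encode p < m)
    (hq : Encodable.encode q < m) (h : cell (sepLevel m) p = cell (sepLevel m) q) : p = q :=
  (exists_separating m).choose_spec p q hp hq
    (cell_eq_of_le ((Nat.le_add_right _ _).trans (sepLevel_ge m)) h)

/-- The finite approximations of the closed part of `X` along `h`. -/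
def stage (X : Set ℚ) (h : ℕ → ℕ) : ℕ → Set ℚ
  | 0 => {q | q ∈ X ∧ Encodable.encode q < h 0}
  | n + 1 => stage X h n ∪ {q | q ∈ X ∧ Encodable.encode q < h (n + 1) ∧
      (((n + 1 : ℕ) : ℤ) ≤ cell 0 q ∨
        ∃ p ∈ stage X h n, cell (sepLevel (h n)) p = cell (sepLevel (h n)) q)}

/-- A closed subset of `X`, depending on a function `f`. -/
def closedPart (X : Set ℚ) (f : ℕ → ℕ) : Set ℚ := ⋃ n, stage X (fun k => f k + k) n

theorem stage_monotone (X : Set ℚ) (h : ℕ → ℕ) : Monotone (stage X h) :=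
  monotone_nat_of_le_succ fun _ => subset_union_left

theorem stage_mono {X Y : Set ℚ} (hXY : X ⊆ Y) (h : ℕ → ℕ) (n : ℕ) :
    stage X h n ⊆ stage Y h n := by
  induction n with
  | zero => exact fun q hq => ⟨hXY hq.1, hq.2⟩
  | succ n ih =>
    refine union_subset_union ih fun q hq => ⟨hXY hq.1, hq.2.1, hq.2.2.imp_right ?_⟩
    rintro ⟨p, hp, hc⟩
    exact ⟨p, ih hp, hc⟩

theorem stage_subset (X : Set ℚ) (h : ℕ → ℕ) (n : ℕ) : stage X h n ⊆ X := by
  induction n with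
  | zero => exact fun q hq => hq.1
  | succ n ih => exact union_subset ih fun q hq => hq.1

theorem encode_lt_of_mem_stage {X : Set ℚ} {h : ℕ → ℕ} (hh : Monotone h) {n : ℕ} {q : ℚ}
    (hq : q ∈ stage X h n) : Encodable.encode q < h n := by
  induction n with
  | zero => exact hq.2
  | succ n ih =>
    rcases hq with hq | hq
    · exact (ih hq).trans_le (hh n.le_succ)
    · exact hq.2.1

theorem closedPart_subset (X : Set ℚ) (f : ℕ → ℕ) : closedPart X f ⊆ X :=
  iUnion_subset fun _ => stage_subset _ _ _

theorem closedPart_mono {X Y : Set ℚ} (h : X ⊆ Y) (f : ℕ → ℕ) : closedPart X f ⊆ closedPart Y f :=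
  iUnion_mono fun _ => stage_mono h _ _

/-- A point `q` outside has a cell that no stage meets: stage `n` misses it by separation of small
codes, and later points enter either to the right of it or from a finer cell that already contains
an earlier point. -/
theorem isClosed_iUnion_stage (X : Set ℚ) {h : ℕ → ℕ} (hh : StrictMono h) :
    IsClosed (⋃ n, stage X h n) := by
  rw [← isOpen_compl_iff, isOpen_iff_mem_nhds]
  intro q hq
  -- Late enough that `q` has code below `h n` and new far-right points lie beyond the unit cell of
  -- `q`.
  set n := max (Encodable.encode q + 1) (cell 0 q + 1).toNat
  have hn1 : Encodable.encode q < h n :=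
    (Nat.lt_of_succ_le (le_max_left _ _)).trans_le (hh.le_apply)
  have hn2 : cell 0 q < n := by
    have : (cell 0 q + 1).toNat ≤ n := le_max_right _ _
    omega
  filter_upwards [cell_mem_nhds (sepLevel (h n)) q] with r hr hrP
  obtain ⟨k, hk⟩ := mem_iUnion.1 hrP
  have key : ∀ j, ∀ p ∈ stage X h (n + j), cell (sepLevel (h n)) p ≠ cell (sepLevel (h n)) q := by
    intro j
    induction j with
    | zero =>
      intro p hp hc
      obtain rfl := eq_of_cell_sepLevel (encode_lt_of_mem_stage hh.monotone hp) hn1 hc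
      exact hq (mem_iUnion.2 ⟨_, hp⟩)
    | succ j ih =>
      rintro p (hp | ⟨-, -, hp | ⟨p', hp', hc'⟩⟩) hc
      · exact ih p hp hc
      · replace hp : ((n + j + 1 : ℕ) : ℤ) ≤ cell 0 p := hp
        rw [cell_eq_of_le (Nat.zero_le _) hc] at hp
        omega
      · refine ih p' hp' (Eq.trans ?_ hc)
        exact cell_eq_of_le (sepLevel_mono (hh.monotone (Nat.le_add_right _ _))) hc'
  exact key k r (stage_monotone X h (Nat.le_add_left k n) hk) hr

theorem isClosed_closedPart (X : Set ℚ) {f : ℕ → ℕ} (hf : Monotone f) :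
    IsClosed (closedPart X f) :=
  isClosed_iUnion_stage X (hf.add_strictMono strictMono_id)

/-- If `h n = m` and `h (n + 1) ≥ N`, stage `n + 1` gains a neighbour of every point of stage `n`
and a point far to the right. -/
theorem exists_growth {X : Set ℚ} (hc : Crowded X) (hu : UnboundedRight X) (m : ℕ) :
    ∃ N : ℕ, (∃ q ∈ X, ((m + 1 : ℕ) : ℤ) ≤ cell 0 q ∧ Encodable.encode q < N) ∧
      ∀ q ∈ X, Encodable.encode q < m → ∃ p ∈ X, p ≠ q ∧
        cell (sepLevel m) q = cell (sepLevel m) p ∧ Encodable.encode p < N := by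
  have hfin : {p : ℚ | Encodable.encode p < m}.Finite :=
    (finite_Iio m).preimage Encodable.encode_injective.injOn
  have : ∀ q : ℚ, ∃ p, q ∈ X → p ∈ X ∧ p ≠ q ∧ cell (sepLevel m) q = cell (sepLevel m) p := by
    intro q
    by_cases hq : q ∈ X
    · obtain ⟨p, hp, hne, he⟩ := hc q hq (sepLevel m)
      exact ⟨p, fun _ => ⟨hp, hne, he.symm⟩⟩
    · exact ⟨0, fun h => absurd h hq⟩
  choose P hP using this
  obtain ⟨b, hb⟩ := (hfin.image fun q => Encodable.encode (P q)).bddAbove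
  obtain ⟨q0, hq0, hq0'⟩ := hu (m + 1)
  refine ⟨max b (Encodable.encode q0) + 1, ⟨q0, hq0, hq0', by omega⟩, fun q hq hqm => ?_⟩
  obtain ⟨h1, h2, h3⟩ := hP q hq
  have : Encodable.encode (P q) ≤ b := hb ⟨q, hqm, rfl⟩
  exact ⟨P q, h1, h2, h3, by omega⟩

/-- If `h (k + 1) < G (h k)` from `n` on, then `h` is bounded by iterates of a monotone inflationary
majorant `H` of `G`. The diagonal `H^[k] k` absorbs the starting value `h n` once `k ≥ n + h n`. -/
theorem exists_bound_of_frequently_lt (G : ℕ → ℕ) : ∃ Φ : ℕ → ℕ, ∀ h : ℕ → ℕ,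
    ¬ LeStar h Φ → ∀ n, ∃ k ≥ n, G (h k) ≤ h (k + 1) := by
  set H : ℕ → ℕ := fun m => m + ∑ i ∈ Finset.range (m + 1), G i with hH
  have hHm : Monotone H := fun a b hab =>
    add_le_add hab (Finset.sum_le_sum_of_subset (Finset.range_mono (by omega)))
  have hHG : ∀ m, G m ≤ H m := fun m => le_add_left
    (Finset.single_le_sum (f := G) (fun _ _ => Nat.zero_le _) (Finset.self_mem_range_succ m))
  have hHid : ∀ m, m ≤ H m := fun m => Nat.le_add_right _ _
  refine ⟨fun n => H^[n] n, fun h hh n => ?_⟩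
  by_contra! hcon
  refine hh ((finite_Iio (n + h n)).subset fun k hk => ?_)
  by_contra hk'
  simp only [mem_Iio, not_lt] at hk'
  refine hk ?_
  have key : ∀ j, h (n + j) ≤ H^[j] (h n) := by
    intro j
    induction j with
    | zero => exact le_rfl
    | succ j ih =>
      rw [Function.iterate_succ_apply']
      exact (hcon (n + j) (Nat.le_add_right _ _)).le.trans ((hHG _).trans (hHm ih))
  obtain ⟨j, rfl⟩ := Nat.exists_eq_add_of_le (show n ≤ k by omega)
  calc h (n + j) ≤ H^[j] (h n) := key j
    _ ≤ H^[n + j] (h n) := by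
      exact Function.monotone_iterate_of_id_le hHid (Nat.le_add_left _ _) _
    _ ≤ H^[n + j] (n + j) := hHm.iterate _ (by omega)

/-- Infinitely many growth steps suffice: every admitted point gets neighbours at arbitrarily fine
levels. Unboundedness provides fresh points at each such step, however late it comes. -/
theorem Positive.exists_control {X : Set ℚ} (hX : Positive X) :
    ∃ Φ : ℕ → ℕ, ∀ f : ℕ → ℕ, Monotone f → ¬ LeStar f Φ → Positive (closedPart X f) := by
  obtain ⟨Z, hZX, hc, hu⟩ := hX
  choose G hG1 hG2 using exists_growth hc hu
  obtain ⟨Φ, hΦ⟩ := exists_bound_of_frequently_lt G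
  refine ⟨Φ, fun f hf hfΦ => ?_⟩
  refine Positive.mono ?_ (closedPart_mono hZX f)
  set h : ℕ → ℕ := fun k => f k + k with hh
  have hhm : StrictMono h := hf.add_strictMono strictMono_id
  have hgood : ∀ n, ∃ k ≥ n, G (h k) ≤ h (k + 1) :=
    hΦ h fun hle => hfΦ (hle.subset fun k hk hle' => hk ((Nat.le_add_right _ _).trans hle'))
  refine ⟨closedPart Z f, subset_rfl, fun q hq n => ?_, fun n => ?_⟩
  · obtain ⟨j, hj⟩ := mem_iUnion.1 hq
    obtain ⟨k, hk, hGk⟩ := hgood (max n j)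
    have hqk := stage_monotone Z h ((le_max_right n j).trans hk) hj
    obtain ⟨p, hp, hpq, hcell, henc⟩ := hG2 (h k) q (closedPart_subset Z f hq)
      (encode_lt_of_mem_stage hhm.monotone hqk)
    refine ⟨p, mem_iUnion.2 ⟨k + 1, Or.inr ⟨hp, henc.trans_le hGk, Or.inr ⟨q, hqk, hcell⟩⟩⟩, hpq,
      cell_eq_of_le ?_ hcell.symm⟩
    exact ((le_max_left n j).trans hk).trans (hhm.le_apply.trans (le_sepLevel _))
  · obtain ⟨k, hk, hGk⟩ := hgood n
    obtain ⟨q, hq, hqc, henc⟩ := hG1 (h k)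
    have hkk : k ≤ h k := hhm.le_apply
    exact ⟨q, mem_iUnion.2 ⟨k + 1, Or.inr ⟨hq, henc.trans_le hGk, Or.inl (by push_cast at hqc ⊢; omega)⟩⟩,
      by push_cast at hqc; omega⟩

/-! ### Projective sets -/

theorem IsSigmaOne.preimage {n : ℕ} : ∀ {X Y : Type} [TopologicalSpace X] [PolishSpace X]
    [TopologicalSpace Y] [T2Space Y] {A : Set Y}, IsSigmaOne n Y A →
    ∀ {φ : X → Y}, Continuous φ → IsSigmaOne n X (φ ⁻¹' A) := by
  induction n with
  | zero => exact fun h _ hφ => AnalyticSet.preimage h hφ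
  | succ n ih =>
    rintro X Y _ _ _ _ A ⟨C, hC, rfl⟩ φ hφ
    refine ⟨(Prod.map φ id) ⁻¹' C, ?_, ?_⟩
    · rw [← preimage_compl]
      exact ih hC (hφ.prodMap continuous_id)
    · ext x
      constructor
      · rintro ⟨⟨y, z⟩, hyz, h⟩
        change y = φ x at h
        subst h
        exact ⟨(x, z), hyz, rfl⟩
      · rintro ⟨⟨x', z⟩, hyz, h⟩
        change x' = x at h
        subst h
        exact ⟨(φ x', z), hyz, rfl⟩

theorem IsProjective.preimage {X Y : Type} [TopologicalSpace X] [PolishSpace X]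
    [TopologicalSpace Y] [T2Space Y] {A : Set Y} (h : IsProjective A) {φ : X → Y}
    (hφ : Continuous φ) : IsProjective (φ ⁻¹' A) :=
  h.imp fun _ h => h.preimage hφ

instance PolishSpace.tuple_prod (k : ℕ) : PolishSpace ((Fin k → ℕ → ℕ) × (ℕ → ℕ)) :=
  have h : ∀ (X Y : Type) [TopologicalSpace X] [TopologicalSpace Y] [PolishSpace X]
    [PolishSpace Y], PolishSpace (X × Y) := fun _ _ => inferInstance
  h _ _

instance BorelSpace.tuple_prod (k : ℕ) : BorelSpace ((Fin k → ℕ → ℕ) × (ℕ → ℕ)) :=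
  have h : ∀ (X Y : Type) [TopologicalSpace X] [TopologicalSpace Y] [MeasurableSpace X]
    [MeasurableSpace Y] [SecondCountableTopology X] [SecondCountableTopology Y] [BorelSpace X]
    [BorelSpace Y], BorelSpace (X × Y) := fun _ _ => inferInstance
  h _ _

/-- The union of a coanalytic set and an analytic set is projective. -/
theorem isProjective_compl_union {X : Type} [TopologicalSpace X] [PolishSpace X] {A B : Set X}
    (hA : AnalyticSet A) (hB : AnalyticSet B) : IsProjective (Aᶜ ∪ B) := by
  refine ⟨1, ?_⟩
  rw [AnalyticSet] at hB
  rcases hB with rfl | ⟨φ, hφ, rfl⟩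
  · refine ⟨Prod.fst ⁻¹' Aᶜ, ?_, ?_⟩
    · rw [← preimage_compl, compl_compl]
      exact AnalyticSet.preimage hA continuous_fst
    · rw [union_empty, image_preimage_eq _ Prod.fst_surjective]
  -- With `B` the range of `φ`, the union is the projection of a coanalytic cylinder together with
  -- the closed graph of `φ`.
  · refine ⟨Prod.fst ⁻¹' Aᶜ ∪ {p | φ p.2 = p.1}, ?_, ?_⟩
    · rw [compl_union, ← preimage_compl, compl_compl]
      have h1 : AnalyticSet ((Prod.fst : X × (ℕ → ℕ) → X) ⁻¹' A) :=
        AnalyticSet.preimage hA continuous_fst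
      have h2 : AnalyticSet {p : X × (ℕ → ℕ) | φ p.2 = p.1}ᶜ := by
        borelize (X × (ℕ → ℕ))
        exact (isClosed_eq (by fun_prop) (by fun_prop)).isOpen_compl.measurableSet.analyticSet
      rw [inter_eq_iInter]
      exact AnalyticSet.iInter fun b => by cases b <;> assumption
    · ext x
      constructor
      · rintro (h | ⟨z, h⟩)
        · exact ⟨(x, 0), Or.inl h, rfl⟩
        · exact ⟨(x, z), Or.inr h, rfl⟩
      · rintro ⟨⟨y, z⟩, h | h, rfl⟩
        · exact Or.inl h
        · exact Or.inr ⟨z, h⟩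

/-! ### Sets of rationals coded by reals -/

/-- The set of rationals coded by `x`. -/
def decodeSet (x : ℕ → ℕ) : Set ℚ := {q | x (Encodable.encode q) ≠ 0}

open Classical in
theorem exists_decodeSet_eq (A : Set ℚ) : ∃ x, decodeSet x = A := by
  refine ⟨fun n => if ∃ q ∈ A, Encodable.encode q = n then 1 else 0, ?_⟩
  ext q
  simp [decodeSet]

/-- A family of sets of rationals that depends measurably on a parameter. -/
def MeasurableFamily {X : Type*} [MeasurableSpace X] (T : X → Set ℚ) : Prop :=
  ∀ q, MeasurableSet {x | q ∈ T x}

section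
variable {X : Type*} [MeasurableSpace X]

theorem measurableFamily_decodeSet {x : X → ℕ → ℕ} (hx : Measurable x) :
    MeasurableFamily fun p => decodeSet (x p) := fun _ =>
  ((measurable_pi_apply _).comp hx) (measurableSet_singleton 0).compl

theorem MeasurableFamily.iInter {ι : Type*} [Countable ι] {T : ι → X → Set ℚ}
    (h : ∀ i, MeasurableFamily (T i)) : MeasurableFamily fun x => ⋂ i, T i x := by
  intro q
  simp only [mem_iInter, ofPred_forall]
  exact MeasurableSet.iInter fun i => h i q

theorem MeasurableFamily.stage {T : X → Set ℚ} (hT : MeasurableFamily T) {h : X → ℕ → ℕ}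
    (hh : Measurable h) (n : ℕ) : MeasurableFamily fun x => stage (T x) (h x) n := by
  have hlt : ∀ (q : ℚ) n, MeasurableSet {x | Encodable.encode q < h x n} := fun q n =>
    ((measurable_pi_apply n).comp hh) (measurableSet_Ioi (a := Encodable.encode q))
  induction n with
  | zero => exact fun q => (hT q).inter (hlt q 0)
  | succ n ih =>
    intro q
    refine (ih q).union ((hT q).inter ((hlt q _).inter ?_))
    refine (MeasurableSet.const _).union ?_
    have : {x | ∃ p ∈ _root_.stage (T x) (h x) n,
        cell (sepLevel (h x n)) p = cell (sepLevel (h x n)) q} =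
        ⋃ p : ℚ, {x | p ∈ _root_.stage (T x) (h x) n} ∩
          (fun x => h x n) ⁻¹' {m | cell (sepLevel m) p = cell (sepLevel m) q} := by
      ext x
      simp
    change MeasurableSet {x | ∃ p ∈ _root_.stage (T x) (h x) n,
        cell (sepLevel (h x n)) p = cell (sepLevel (h x n)) q}
    rw [this]
    exact MeasurableSet.iUnion fun p => (ih p).inter
      (((measurable_pi_apply n).comp hh) (MeasurableSet.of_discrete))

theorem MeasurableFamily.closedPart {T : X → Set ℚ} (hT : MeasurableFamily T) {f : X → ℕ → ℕ}
    (hf : Measurable f) : MeasurableFamily fun x => closedPart (T x) (f x) := by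
  intro q
  simp only [_root_.closedPart, mem_iUnion, ofPred_exists]
  refine MeasurableSet.iUnion fun n => hT.stage (h := fun x k => f x k + k) ?_ n q
  exact measurable_pi_lambda _ fun k => ((measurable_pi_apply k).comp hf).add_const k

end

/-- A real codes the witnessing crowded set, and being a witness is a Borel condition, so the set is
a projection of a Borel set. -/
theorem MeasurableFamily.analyticSet_positive {X : Type} [TopologicalSpace X] [PolishSpace X]
    [MeasurableSpace X] [BorelSpace X] {T : X → Set ℚ} (hT : MeasurableFamily T) :
    AnalyticSet {x | Positive (T x)} := by
  have hd : MeasurableFamily fun p : X × (ℕ → ℕ) => decodeSet p.2 :=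
    measurableFamily_decodeSet measurable_snd
  have hB : MeasurableSet {p : X × (ℕ → ℕ) | decodeSet p.2 ⊆ T p.1 ∧ Crowded (decodeSet p.2) ∧
      UnboundedRight (decodeSet p.2)} := by
    refine MeasurableSet.inter ?_ (MeasurableSet.inter ?_ ?_)
    · have : {p : X × (ℕ → ℕ) | decodeSet p.2 ⊆ T p.1} =
          ⋂ q : ℚ, {p | q ∈ decodeSet p.2}ᶜ ∪ {p | q ∈ T p.1} := by
        ext p
        simp [subset_def, imp_iff_not_or]
      change MeasurableSet {p : X × (ℕ → ℕ) | decodeSet p.2 ⊆ T p.1}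
      rw [this]
      exact MeasurableSet.iInter fun q => (hd q).compl.union (measurable_fst (hT q))
    · have : {p : X × (ℕ → ℕ) | Crowded (decodeSet p.2)} =
          ⋂ q : ℚ, {p | q ∈ decodeSet p.2}ᶜ ∪ ⋂ n, ⋃ r : ℚ, {p | r ∈ decodeSet p.2} ∩
            {_p | r ≠ q ∧ cell n r = cell n q} := by
        ext p
        simp [Crowded, imp_iff_not_or]
      change MeasurableSet {p : X × (ℕ → ℕ) | Crowded (decodeSet p.2)}
      rw [this]
      exact MeasurableSet.iInter fun q => (hd q).compl.union <| MeasurableSet.iInter fun n =>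
        MeasurableSet.iUnion fun r => (hd r).inter (MeasurableSet.const _)
    · have : {p : X × (ℕ → ℕ) | UnboundedRight (decodeSet p.2)} =
          ⋂ n : ℕ, ⋃ q : ℚ, {p | q ∈ decodeSet p.2} ∩ {_p | (n : ℤ) ≤ cell 0 q} := by
        ext p
        simp [UnboundedRight]
      change MeasurableSet {p : X × (ℕ → ℕ) | UnboundedRight (decodeSet p.2)}
      rw [this]
      exact MeasurableSet.iInter fun n =>
        MeasurableSet.iUnion fun r => (hd r).inter (MeasurableSet.const _)
  convert hB.analyticSet_image measurable_fst using 1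
  ext x
  constructor
  · rintro ⟨Z, hZ, h⟩
    obtain ⟨z, rfl⟩ := exists_decodeSet_eq Z
    exact ⟨(x, z), ⟨hZ, h⟩, rfl⟩
  · rintro ⟨⟨y, z⟩, ⟨hZ, h⟩, rfl⟩
    exact ⟨_, hZ, h⟩

/-! ### The relations to which the pathway is applied -/

/-- The intersection over `a < m` of the sets coded by `x a`, each of them replaced by its closed
part along `x (m + a)` if `b a` is true, and by its image under `C` otherwise. -/
def meetSet {m : ℕ} (b : Fin m → Bool) (x : Fin (m + m) → ℕ → ℕ) (C : Set ℚ → Set ℚ) : Set ℚ :=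
  ⋂ a, if b a then closedPart (decodeSet (x (Fin.castAdd m a))) (x (Fin.natAdd m a))
    else C (decodeSet (x (Fin.castAdd m a)))

/-- Positivity of the meet is preserved when sets are replaced by their closed parts along `g`. -/
def meetRel (m : ℕ) (b : Fin m → Bool) : Set ((Fin (m + m) → ℕ → ℕ) × (ℕ → ℕ)) :=
  {p | Positive (meetSet b p.1 id)}ᶜ ∪
    {p | Positive (meetSet b p.1 fun A => closedPart A p.2)}

theorem isProjective_meetRel (m : ℕ) (b : Fin m → Bool) : IsProjective (meetRel m b) := by
  have hx : ∀ a, Measurable fun p : (Fin (m + m) → ℕ → ℕ) × (ℕ → ℕ) => p.1 a := fun a =>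
    (measurable_pi_apply a).comp measurable_fst
  refine isProjective_compl_union (MeasurableFamily.analyticSet_positive ?_)
    (MeasurableFamily.analyticSet_positive ?_)
  all_goals
    refine MeasurableFamily.iInter fun a => ?_
    cases b a
  · exact measurableFamily_decodeSet (hx _)
  · exact (measurableFamily_decodeSet (hx _)).closedPart (hx _)
  · exact (measurableFamily_decodeSet (hx _)).closedPart measurable_snd
  · exact (measurableFamily_decodeSet (hx _)).closedPart (hx _)

theorem closedPart_meetSet_subset {m : ℕ} (b : Fin m → Bool) (x : Fin (m + m) → ℕ → ℕ)
    (g : ℕ → ℕ) : closedPart (meetSet b x id) g ⊆ meetSet b x fun A => closedPart A g := by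
  refine subset_iInter fun a => ?_
  have h := iInter_subset (fun a => if b a then
    closedPart (decodeSet (x (Fin.castAdd m a))) (x (Fin.natAdd m a))
    else id (decodeSet (x (Fin.castAdd m a)))) a
  change meetSet b x id ⊆ _ at h
  cases hb : b a
  · rw [hb] at h
    exact closedPart_mono h g
  · rw [hb] at h
    exact (closedPart_subset _ _).trans h

theorem isAdequate_meetRel (m : ℕ) (b : Fin m → Bool) : IsAdequate (meetRel m b) := by
  intro x
  by_cases hp : Positive (meetSet b x id)
  · obtain ⟨Φ, hΦ⟩ := hp.exists_control
    exact ⟨Φ, fun g hg hgΦ => Or.inr ((hΦ g hg hgΦ).mono (closedPart_meetSet_subset b x g))⟩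
  · exact ⟨0, fun g _ _ => Or.inl hp⟩

/-! ### Closure properties of `H(κ)` -/

section HSet
open Cardinal

variable {κ : Cardinal.{u}}

/-- The transitive closure is a union of fewer than `κ` sets of size less than `κ`, and `κ` is
regular. -/
theorem mem_hSet_of_forall_mem (hκ : κ.IsRegular) (hc : continuum.{u} < κ) {x : ZFSet.{u}}
    (hx : ∀ y ∈ x, y ∈ hSet κ) (hcard : #{y | y ∈ x} ≤ continuum.{u + 1}) : x ∈ hSet κ := by
  have hκ' : (lift.{u + 1} κ).IsRegular := hκ.lift
  have hsub : trcl x ⊆ ⋃ y ∈ {y | y ∈ x}, insert y (trcl y) := by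
    intro z hz
    simp only [mem_iUnion]
    cases hz with
    | single h => exact ⟨z, h, mem_insert _ _⟩
    | tail h h' => exact ⟨_, h', mem_insert_of_mem _ h⟩
  refine (mk_le_mk_of_subset hsub).trans_lt ?_
  have hlt : #{y | y ∈ x} < lift.{u + 1} κ := by
    refine hcard.trans_lt ?_
    rw [← lift_continuum.{u + 1, u}]
    exact lift_lt.2 hc
  rw [card_biUnion_lt_iff_forall_of_isRegular hκ' hlt]
  intro y hy
  exact mk_insert_le.trans_lt
    (add_lt_of_lt hκ'.aleph0_le (hx y hy) (one_lt_aleph0.trans_le hκ'.aleph0_le))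

theorem mem_hSet_of_countable (hκ : κ.IsRegular) (hc : continuum.{u} < κ) {x : ZFSet.{u}}
    (hx : ∀ y ∈ x, y ∈ hSet κ) (hcard : {y | y ∈ x}.Countable) : x ∈ hSet κ :=
  mem_hSet_of_forall_mem hκ hc hx (hcard.le_aleph0.trans aleph0_le_continuum)

theorem pair_mem_hSet (hκ : κ.IsRegular) (hc : continuum.{u} < κ) {x y : ZFSet.{u}}
    (hx : x ∈ hSet κ) (hy : y ∈ hSet κ) : ZFSet.pair x y ∈ hSet κ := by
  have key : ∀ {a b : ZFSet.{u}}, a ∈ hSet κ → b ∈ hSet κ → ({a, b} : ZFSet.{u}) ∈ hSet κ := by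
    intro a b ha hb
    refine mem_hSet_of_countable hκ hc (fun z hz => ?_) ?_
    · rcases ZFSet.mem_pair.1 hz with rfl | rfl <;> assumption
    · exact (toFinite {a, b}).countable.mono fun z hz => ZFSet.mem_pair.1 hz
  refine key ?_ (key hx hy)
  rw [← ZFSet.pair_eq_singleton]
  exact key hx hx

theorem range_mem_hSet (hκ : κ.IsRegular) (hc : continuum.{u} < κ) {α : Type} (hα : #α ≤ continuum)
    {g : α → ZFSet.{u}} (hg : ∀ a, g a ∈ hSet κ) : ZFSet.range g ∈ hSet κ := by
  refine mem_hSet_of_forall_mem hκ hc (fun y hy => ?_) ?_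
  · obtain ⟨a, rfl⟩ := ZFSet.mem_range.1 hy
    exact hg a
  · have h1 : {y | y ∈ ZFSet.range g} = range g := by
      ext y
      simp
    have h2 := mk_range_le_lift (f := g)
    rw [h1]
    rw [lift_uzero] at h2
    exact h2.trans ((Cardinal.lift_le.2 hα).trans_eq lift_continuum)

theorem countable_Iio_of_lt_omegaOne {α : Ordinal.{u}} (hα : α < omegaOne) :
    (Iio α).Countable := by
  rw [← le_aleph0_iff_set_countable, mk_Iio_ordinal]
  rw [lt_omega_iff_card_lt, ← succ_aleph0, Order.lt_succ_iff] at hα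
  exact lift_le_aleph0.2 hα

theorem toZFSet_mem_hSet (hκ : κ.IsRegular) (hc : continuum.{u} < κ) {α : Ordinal.{u}}
    (hα : α < omegaOne) : α.toZFSet ∈ hSet κ := by
  induction α using WellFoundedLT.induction with
  | ind α ih =>
    refine mem_hSet_of_countable hκ hc (fun y hy => ?_) ?_
    · obtain ⟨β, hβ, rfl⟩ := Ordinal.mem_toZFSet_iff.1 hy
      exact ih β hβ (hβ.trans hα)
    · refine ((countable_Iio_of_lt_omegaOne hα).image Ordinal.toZFSet).mono fun y hy => ?_
      exact Ordinal.mem_toZFSet_iff.1 hy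

theorem natCode_mem_hSet (hκ : κ.IsRegular) (hc : continuum.{u} < κ) (n : ℕ) :
    natCode n ∈ hSet κ :=
  toZFSet_mem_hSet hκ hc ((Ordinal.natCast_lt_omega0 n).trans Ordinal.omega0_lt_omega_one)

theorem realCode_mem_hSet (hκ : κ.IsRegular) (hc : continuum.{u} < κ) (f : ℕ → ℕ) :
    realCode f ∈ hSet κ :=
  range_mem_hSet hκ hc (mk_le_aleph0.trans aleph0_le_continuum) fun _ =>
    pair_mem_hSet hκ hc (natCode_mem_hSet hκ hc _) (natCode_mem_hSet hκ hc _)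

theorem relCode_mem_hSet (hκ : κ.IsRegular) (hc : continuum.{u} < κ) {k : ℕ}
    (R : Set ((Fin k → ℕ → ℕ) × (ℕ → ℕ))) : relCode R ∈ hSet κ := by
  refine range_mem_hSet hκ hc ((mk_set_le R).trans ?_) fun p => pair_mem_hSet hκ hc
    (range_mem_hSet hκ hc (mk_le_aleph0.trans aleph0_le_continuum) fun _ =>
      pair_mem_hSet hκ hc (natCode_mem_hSet hκ hc _) (realCode_mem_hSet hκ hc _))
    (realCode_mem_hSet hκ hc _)
  have h1 : #(ℕ → ℕ) = continuum := by simp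
  have h2 : #(Fin k → ℕ → ℕ) ≤ continuum := by
    rw [← power_def, h1, mk_fin, power_natCast]
    exact (power_nat_le aleph0_le_continuum)
  rw [mk_prod, lift_id, lift_id, h1]
  exact (mul_le_mul_left h2 _).trans continuum_mul_self.le

end HSet

/-! ### Clubs and heights -/

/-- The countable subsets of `A` which contain `Z` and are closed under `φ` form a club. -/
theorem isClubFamily_closed {X : Type v} {A Z : Set X} (hZ : Z ⊆ A) (hZc : Z.Countable)
    {φ : X → X} (hφ : MapsTo φ A A) :
    IsClubFamily A {M | M ⊆ A ∧ M.Countable ∧ Z ⊆ M ∧ MapsTo φ M M} := by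
  refine ⟨fun M hM => ⟨hM.1, hM.2.1⟩, fun Y hY hYc => ?_, fun M _ hM => ⟨?_, ?_, ?_, ?_⟩⟩
  · refine ⟨⋃ n, φ^[n] '' (Y ∪ Z), ⟨?_, ?_, ?_, ?_⟩, ?_⟩
    · refine iUnion_subset fun n => ?_
      rintro _ ⟨x, hx, rfl⟩
      exact hφ.iterate n (union_subset hY hZ hx)
    · exact countable_iUnion fun n => (hYc.union hZc).image _
    · exact fun x hx => mem_iUnion.2 ⟨0, x, Or.inr hx, rfl⟩
    · intro x hx
      obtain ⟨n, y, hy, rfl⟩ := mem_iUnion.1 hx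
      exact mem_iUnion.2 ⟨n + 1, y, hy, Function.iterate_succ_apply' φ n y⟩
    · exact fun x hx => mem_iUnion.2 ⟨0, x, Or.inl hx, rfl⟩
  · exact iUnion_subset fun i => (hM i).1
  · exact countable_iUnion fun i => (hM i).2.1
  · exact (hM 0).2.2.1.trans (subset_iUnion M 0)
  · exact mapsTo_iUnion_iUnion fun i => (hM i).2.2.2

theorem toZFSet_mem_of_lt_height {M : Set ZFSet.{u}} {α : Ordinal.{u}} (h : α < height M) :
    α.toZFSet ∈ M := by
  have := notMem_of_lt_csInf' h
  simp only [mem_ofPred_eq, not_not] at this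
  exact this.2

theorem height_lt_omegaOne {M : Set ZFSet.{u}} (hM : M.Countable) : height M < omegaOne := by
  by_contra h
  have h1 : MapsTo Ordinal.toZFSet (Iio omegaOne) M := fun α hα =>
    toZFSet_mem_of_lt_height (lt_of_lt_of_le hα (not_lt.1 h))
  have h2 : (Iio omegaOne.{u}).Countable :=
    h1.countable_of_injOn Ordinal.toZFSet_injective.injOn hM
  rw [← Cardinal.le_aleph0_iff_set_countable, Cardinal.mk_Iio_ordinal] at h2
  simp at h2

/-! ### The combinatorial content of a pathway -/

/-- This isolates what the construction needs from the models. A club ensures that they contain the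
countably many relations required and are closed under `α ↦ f α`; `E` is the set of their heights.
-/
theorem IsMultipleDPathway.exists_increasing_cover {κ : Cardinal.{u}} {r : hSet κ → hSet κ → Prop}
    {f : Ordinal.{u} → ℕ → ℕ} {S : Set (Set ZFSet.{u})} (h : IsMultipleDPathway κ r f S)
    {ι : Type} [Countable ι] {k : ι → ℕ} (R : ∀ i, Set ((Fin (k i) → ℕ → ℕ) × (ℕ → ℕ)))
    (hproj : ∀ i, IsProjective (R i)) (hadeq : ∀ i, IsAdequate (R i)) :
    ∃ (E : Set Ordinal.{u}) (L : Ordinal.{u} → Set (ℕ → ℕ)), Monotone L ∧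
      (∀ δ ∈ E, Monotone (f δ)) ∧ (∀ x, ∃ δ ∈ E, x ∈ L δ) ∧
      (∀ δ ∈ E, ∀ δ' < δ, f δ' ∈ L δ) ∧
      ∀ i, ∀ δ ∈ E, ∀ x : Fin (k i) → ℕ → ℕ, (∀ j, x j ∈ L δ) → (x, f δ) ∈ R i := by
  classical
  obtain ⟨hκ, hc, -, hinc, -, ⟨hS, hstat⟩, -, hpath⟩ := h
  -- Permuting coordinates allows parameters from models listed in any order. The ignored last
  -- coordinate makes room for the model that contains the relation and determines the height.
  let ext (i : ι) (σ : Equiv.Perm (Fin (k i))) (p : (Fin (k i + 1) → ℕ → ℕ) × (ℕ → ℕ)) :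
    (Fin (k i) → ℕ → ℕ) × (ℕ → ℕ) := (fun j => p.1 (σ j).castSucc, p.2)
  let Z : Set ZFSet.{u} := insert (realCode 0)
    (range fun p : Σ i, Equiv.Perm (Fin (k i)) => relCode (ext p.1 p.2 ⁻¹' R p.1))
  have hZc : Z.Countable := (countable_range _).insert _
  have hZ : Z ⊆ hSet κ := by
    refine insert_subset (realCode_mem_hSet hκ hc _) ?_
    rintro _ ⟨p, rfl⟩
    exact relCode_mem_hSet hκ hc _
  let φ : ZFSet.{u} → ZFSet.{u} := fun z =>
    if h : ∃ α < omegaOne, α.toZFSet = z then realCode (f h.choose) else z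
  have hφα : ∀ α < omegaOne, φ α.toZFSet = realCode (f α) := by
    intro α hα
    have hex : ∃ β < omegaOne, β.toZFSet = α.toZFSet := ⟨α, hα, rfl⟩
    simp only [φ, dif_pos hex]
    rw [Ordinal.toZFSet_injective hex.choose_spec.2]
  have hφ : MapsTo φ (hSet κ) (hSet κ) := by
    intro z hz
    by_cases hex : ∃ α < omegaOne, α.toZFSet = z
    · obtain ⟨α, hα, rfl⟩ := hex
      rw [hφα α hα]
      exact realCode_mem_hSet hκ hc _
    · simpa only [φ, dif_neg hex] using hz
  let S' : Set (Set ZFSet.{u}) := {M | M ∈ S ∧ Z ⊆ M ∧ MapsTo φ M M}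
  have hcof : ∀ Y ⊆ hSet κ, Y.Countable → ∃ M ∈ S', Y ⊆ M := by
    intro Y hY hYc
    obtain ⟨M, hMS, -, -, hM, hMφ⟩ := hstat _
      (isClubFamily_closed (union_subset hY hZ) (hYc.union hZc) hφ)
    exact ⟨M, ⟨hMS, subset_union_right.trans hM, hMφ⟩, subset_union_left.trans hM⟩
  refine ⟨height '' S', fun δ => {x | ∃ M ∈ S', height M ≤ δ ∧ realCode x ∈ M}, ?_, ?_, ?_, ?_, ?_⟩
  · rintro δ δ' hδ x ⟨M, hM, hle, hx⟩
    exact ⟨M, hM, hle.trans hδ, hx⟩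
  · rintro _ ⟨M, hM, rfl⟩
    exact hinc _ (height_lt_omegaOne (hS M hM.1).2)
  · intro x
    obtain ⟨M, hM, hx⟩ := hcof {realCode x} (singleton_subset_iff.2 (realCode_mem_hSet hκ hc x))
      (countable_singleton _)
    exact ⟨_, ⟨M, hM, rfl⟩, M, hM, le_rfl, hx rfl⟩
  · rintro _ ⟨M, hM, rfl⟩ δ' hδ'
    refine ⟨M, hM, le_rfl, ?_⟩
    rw [← hφα δ' (hδ'.trans (height_lt_omegaOne (hS M hM.1).2))]
    exact hM.2.2 (toZFSet_mem_of_lt_height hδ')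
  · rintro i _ ⟨M, hM, rfl⟩ x hx
    choose N hNS hNle hxN using hx
    -- The pathway wants increasing heights, so the models are sorted; the relation permuted by
    -- `σ⁻¹` undoes this.
    let σ := Tuple.sort fun j => height (N j)
    have hσ : Monotone fun j => height (N (σ j)) := Tuple.monotone_sort fun j => height (N j)
    let M' : Fin (k i + 1) → Set ZFSet.{u} := Fin.snoc (fun j => N (σ j)) M
    let x' : Fin (k i + 1) → ℕ → ℕ := Fin.snoc (fun j => x (σ j)) 0
    have hcont : Continuous (ext i σ⁻¹) := by
      refine Continuous.prodMk (continuous_pi fun j => ?_) continuous_snd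
      exact (continuous_apply _).comp continuous_fst
    have key := hpath (k i) M' ?_ ?_ (ext i σ⁻¹ ⁻¹' R i) ((hproj i).preimage hcont) ?_ ?_ x' ?_
    · have h1 : ext i σ⁻¹ (x', f (height (M' (Fin.last _)))) = (x, f (height M)) := by
        refine Prod.ext (funext fun j => ?_) ?_
        · simp [ext, x']
        · simp [ext, M']
      rw [mem_preimage, h1] at key
      exact key
    · intro j
      refine Fin.lastCases ?_ (fun j => ?_) j
      · simpa [M'] using hM.1
      · simpa [M'] using (hNS (σ j)).1
    · intro a b hab
      induction b using Fin.lastCases with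
      | last =>
        induction a using Fin.lastCases with
        | last => exact le_rfl
        | cast a => simpa [M'] using hNle (σ a)
      | cast b =>
        induction a using Fin.lastCases with
        | last => exact absurd hab (not_le.2 (Fin.castSucc_lt_last b))
        | cast a => simpa [M'] using hσ (Fin.castSucc_le_castSucc_iff.1 hab)
    · intro y
      obtain ⟨Φ, hΦ⟩ := hadeq i fun j => y (σ⁻¹ j).castSucc
      exact ⟨Φ, fun g hg hgΦ => hΦ g hg hgΦ⟩
    · have : relCode (ext i σ⁻¹ ⁻¹' R i) ∈ Z := mem_insert_of_mem _ ⟨⟨i, σ⁻¹⟩, rfl⟩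
      simpa [M'] using hM.2.1 this
    · intro j
      refine Fin.lastCases ?_ (fun j => ?_) j
      · simpa [M', x'] using hM.2.1 (mem_insert _ _)
      · simpa [M', x'] using hxN (σ j)

/-! ### Construction of the ultrafilter -/

section Construction
variable {f : Ordinal.{u} → ℕ → ℕ} {E : Set Ordinal.{u}} {L : Ordinal.{u} → Set (ℕ → ℕ)}

/-- The closed parts along `f δ`, for `δ ∈ D`, of the members of `W δ` with a code in `L δ`. -/
def closedPartFamily (f : Ordinal.{u} → ℕ → ℕ) (L : Ordinal.{u} → Set (ℕ → ℕ))
    (W : Ordinal.{u} → Ultrafilter ℚ) (D : Set Ordinal.{u}) : Set (Set ℚ) :=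
  {A | ∃ δ ∈ D, ∃ x ∈ L δ, decodeSet x ∈ W δ ∧ A = closedPart (decodeSet x) (f δ)}

/-- `U` consists of positive sets and extends the closed part family of `W` on `D`. -/
def ExtendsFamily (f : Ordinal.{u} → ℕ → ℕ) (L : Ordinal.{u} → Set (ℕ → ℕ))
    (W : Ordinal.{u} → Ultrafilter ℚ) (D : Set Ordinal.{u}) (U : Ultrafilter ℚ) : Prop :=
  (∀ A ∈ U, Positive A) ∧ ∀ A ∈ closedPartFamily f L W D, A ∈ U

/-- In a finite subfamily with largest height `d a₀`, the closed parts of smaller height and the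
uncut sets of height `d a₀` all lie in `W (d a₀)`, so their meet is positive. Then `meetRel`
replaces the uncut sets by closed parts along `f (d a₀)`. -/
theorem exists_extendsFamily (hL : Monotone L) (hfL : ∀ δ ∈ E, ∀ δ' < δ, f δ' ∈ L δ)
    (hR : ∀ m b, ∀ δ ∈ E, ∀ x : Fin (m + m) → ℕ → ℕ, (∀ j, x j ∈ L δ) → (x, f δ) ∈ meetRel m b)
    {W : Ordinal.{u} → Ultrafilter ℚ} {D : Set Ordinal.{u}} (hD : D ⊆ E)
    (hW : ∀ δ ∈ D, ExtendsFamily f L W (E ∩ Iio δ) (W δ)) :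
    ∃ U, ExtendsFamily f L W D U := by
  classical
  refine exists_ultrafilter_positive fun t ht htf => ?_
  obtain ⟨m, A, -, rfl⟩ := htf.fin_param
  rw [range_subset_iff] at ht
  choose d hdD x hxL hxW hA using ht
  rcases isEmpty_or_nonempty (Fin m) with hm | hm
  · rw [range_eq_empty, sInter_empty]
    exact positive_univ
  obtain ⟨a₀, ha₀⟩ := Finite.exists_max d
  let b : Fin m → Bool := fun a => decide (d a < d a₀)
  -- At the top height `f (d a)` need not lie in `L (d a₀)`, so `x a` fills the slot, which
  -- `meetSet` ignores there.
  let y : Fin (m + m) → ℕ → ℕ := Fin.append x fun a => if d a < d a₀ then f (d a) else x a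
  have hy : ∀ j, y j ∈ L (d a₀) := by
    intro j
    induction j using Fin.addCases with
    | left a => simpa [y] using hL (ha₀ a) (hxL a)
    | right a =>
      simp only [y, Fin.append_right]
      split_ifs with h
      · exact hfL _ (hD (hdD a₀)) _ h
      · exact hL (ha₀ a) (hxL a)
  have hmeet : ∀ C, meetSet b y C =
      ⋂ a, if d a < d a₀ then closedPart (decodeSet (x a)) (f (d a)) else C (decodeSet (x a)) := by
    intro C
    refine iInter_congr fun a => ?_
    by_cases h : d a < d a₀ <;> simp only [b, y, h, Fin.append_left, Fin.append_right,
      decide_true, decide_false, if_true, if_false, Bool.false_eq_true]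
  have hpos : Positive (meetSet b y id) := by
    refine (hW _ (hdD a₀)).1 _ ?_
    rw [hmeet]
    refine iInter_mem.2 fun a => ?_
    split_ifs with h
    · exact (hW _ (hdD a₀)).2 _ ⟨d a, ⟨hD (hdD a), h⟩, x a, hxL a, hxW a, rfl⟩
    · rw [← (ha₀ a).eq_of_not_lt h]
      exact hxW a
  have hpos' := (hR m b _ (hD (hdD a₀)) y hy).resolve_left fun h => h hpos
  refine Positive.mono hpos' ?_
  rw [hmeet, sInter_range]
  refine iInter_mono fun a => ?_
  rw [hA a]
  split_ifs with h
  · exact subset_rfl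
  · rw [← (ha₀ a).eq_of_not_lt h]

theorem exists_forall_extendsFamily (hL : Monotone L) (hfL : ∀ δ ∈ E, ∀ δ' < δ, f δ' ∈ L δ)
    (hR : ∀ m b, ∀ δ ∈ E, ∀ x : Fin (m + m) → ℕ → ℕ, (∀ j, x j ∈ L δ) → (x, f δ) ∈ meetRel m b) :
    ∃ W : Ordinal.{u} → Ultrafilter ℚ, ∀ δ, ExtendsFamily f L W (E ∩ Iio δ) (W δ) := by
  classical
  -- The default `pure 0` is harmless: the family over `E ∩ Iio δ` reads only values below `δ`.
  let step (δ : Ordinal.{u}) (w : ∀ δ' < δ, Ultrafilter ℚ) : Ultrafilter ℚ :=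
    Classical.epsilon (ExtendsFamily f L (fun δ' => if h : δ' < δ then w δ' h else pure 0)
      (E ∩ Iio δ))
  let W : Ordinal.{u} → Ultrafilter ℚ := (wellFounded_lt (α := Ordinal.{u})).fix step
  have hW : ∀ δ, W δ = Classical.epsilon (ExtendsFamily f L W (E ∩ Iio δ)) := by
    intro δ
    have h1 : W δ = step δ fun δ' _ => W δ' := WellFounded.fix_eq _ _ _
    rw [h1]
    simp only [step]
    congr 1
    funext U
    have : closedPartFamily f L (fun δ' => if δ' < δ then W δ' else pure 0) (E ∩ Iio δ) =
        closedPartFamily f L W (E ∩ Iio δ) := by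
      ext A
      refine exists_congr fun δ' => and_congr_right fun hδ' => ?_
      simp only [if_pos (show δ' < δ from hδ'.2)]
    simp only [ExtendsFamily, dite_eq_ite, this]
  refine ⟨W, fun δ => ?_⟩
  induction δ using WellFoundedLT.induction with
  | ind δ ih =>
    rw [hW]
    exact Classical.epsilon_spec
      (exists_extendsFamily hL hfL hR inter_subset_left fun δ' hδ' => ih δ' hδ'.2)

/-- Removing the crowded kernel leaves a non-positive set, so kernels of members are members, and
the kernel of a closed set is perfect. Singletons are not positive, which gives non-principality. -/
theorem isGruff_of_closed_base {U : Ultrafilter ℚ} (hpos : ∀ A ∈ U, Positive A)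
    (hU : ∀ A ∈ U, ∃ C ∈ U, C ⊆ A ∧ IsClosed C) : IsGruff U := by
  have hker : ∀ A ∈ U, crowdedKernel A ∈ U := by
    intro A hA
    by_contra h
    exact not_positive_diff_crowdedKernel A
      (hpos _ (inter_mem hA (Ultrafilter.compl_mem_iff_notMem.2 h)))
  refine ⟨?_, {P | P ∈ U ∧ Perfect P}, fun P hP => ⟨hP.1, hP.2, U.nonempty_of_mem hP.1⟩, ?_⟩
  · rw [le_cofinite_iff_compl_singleton_mem]
    intro q
    by_contra h
    rw [Ultrafilter.mem_coe, Ultrafilter.compl_mem_iff_notMem, not_not] at h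
    obtain ⟨Z, hZ, hc, hu⟩ := hpos _ h
    obtain ⟨p, hp, -⟩ := hu 0
    obtain ⟨r, hr, hrp, -⟩ := hc p hp 0
    exact hrp ((hZ hr).trans (hZ hp).symm)
  · intro A hA
    obtain ⟨C, hCU, hCA, hC⟩ := hU A hA
    exact ⟨crowdedKernel C,
      ⟨hker C hCU, (crowded_crowdedKernel C).perfect (isClosed_crowdedKernel hC)⟩,
      (crowdedKernel_subset C).trans hCA⟩

end Construction

theorem mainTheorem4
    (h : ∃ (κ : Cardinal.{u}) (r : hSet κ → hSet κ → Prop) (f : Ordinal.{u} → ℕ → ℕ)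
      (S : Set (Set ZFSet.{u})), IsMultipleDPathway κ r f S) :
    ∃ U : Ultrafilter ℚ, IsGruff U := by
  obtain ⟨κ, r, f, S, h⟩ := h
  obtain ⟨E, L, hL, hf, hcov, hfL, hR⟩ := h.exists_increasing_cover
    (ι := Σ m, (Fin m → Bool)) (k := fun i => i.1 + i.1) (fun i => meetRel i.1 i.2)
    (fun i => isProjective_meetRel i.1 i.2) (fun i => isAdequate_meetRel i.1 i.2)
  replace hR := fun m b => hR ⟨m, b⟩
  obtain ⟨W, hW⟩ := exists_forall_extendsFamily hL hfL hR
  obtain ⟨U, hpos, hU⟩ := exists_extendsFamily hL hfL hR subset_rfl fun δ _ => hW δ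
  refine ⟨U, isGruff_of_closed_base hpos fun A hA => ?_⟩
  obtain ⟨x, rfl⟩ := exists_decodeSet_eq A
  -- The complement needs a code too: `W δ` may contain it instead, which would contradict `hA`.
  obtain ⟨y, hy⟩ := exists_decodeSet_eq (decodeSet x)ᶜ
  obtain ⟨δ, hδ, hxδ, hyδ⟩ : ∃ δ ∈ E, x ∈ L δ ∧ y ∈ L δ := by
    obtain ⟨δ₁, h₁, hx⟩ := hcov x
    obtain ⟨δ₂, h₂, hy⟩ := hcov y
    rcases le_total δ₁ δ₂ with hle | hle
    · exact ⟨δ₂, h₂, hL hle hx, hy⟩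
    · exact ⟨δ₁, h₁, hx, hL hle hy⟩
  rcases (W δ).mem_or_compl_mem (decodeSet x) with hx | hx
  · exact ⟨_, hU _ ⟨δ, hδ, x, hxδ, hx, rfl⟩, closedPart_subset _ _,
      isClosed_closedPart _ (hf δ hδ)⟩
  · rw [← hy] at hx
    have h1 : (decodeSet x)ᶜ ∈ U := by
      rw [← hy]
      exact mem_of_superset (hU _ ⟨δ, hδ, y, hyδ, hx, rfl⟩) (closedPart_subset _ _)
    exact absurd hA (Ultrafilter.compl_mem_iff_notMem.1 h1)
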